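/- Let $K$ be an algebraically closed field of characteristic $0$ and let $R=K[x_0,x_1,x_2]$. Let $1\le r\le s$, and let $P_1,\dots,P_r$ and $Q_1,\dots,Q_s$ be points of $\mathbb P^2_K$ with all homogeneous coordinates non-zero, the $P_i$ lying on a line $\ell_P$ and the $Q_j$ on a line $\ell_Q$. Write $p\star q=[p_0q_0:p_1q_1:p_2q_2]$ for the Hadamard product of points, and $p\star L=\{p\star q: q\in L,\ p\star q \text{ defined}\}$ for a line $L$. Assume that the $rs$ points $P_i\star Q_j$ are pairwise distinct and form a grid, that is, that the lines $P_i\star\ell_Q$ and $\ell_P\star Q_j$ are different for all $i,j$ (so that they meet exactly in $P_i\star Q_j$). Let $1\le m_1\le\dots\le m_r$ and $1\le n_1\le\dots\le n_s$ be integers. For a point $p$ let $I(p)\subset R$ be the ideal generated by all homogeneous polynomials vanishing at $p$, and put $I(P_M)=\bigcap_{i=1}^r I(P_i)^{m_i}$ and $I(Q_N)=\bigcap_{j=1}^s I(Q_j)^{n_j}$. For ideals $I,J\subset R$ let $$I\star J=\bigl(I(\mathbf y)+J(\mathbf z)+\langle x_i-y_iz_i: i=0,1,2\rangle\bigr)\cap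 K[\mathbf x]$$ be their Hadamard product, where $I(\mathbf y)$, $J(\mathbf z)$ are the images of $I$, $J$ under $\mathbf x\mapsto\mathbf y$ and $\mathbf x\mapsto\mathbf z$ in $K[\mathbf x,\mathbf y,\mathbf z]$. Let $\mathcal I(P_M,Q_N)=I(P_M)\star I(Q_N)$ be the ideal of the Hadamard fat grid. Then the least degree $\alpha(\mathcal I(P_M,Q_N))$ of a non-zero homogeneous element of $\mathcal I(P_M,Q_N)$ is $$\alpha(\mathcal I(P_M,Q_N))=\sum_{i=1}^r m_i+\sum_{i=1}^r n_{s-i+1}-r ,$$ and this number is also the least degree of an element of any set of non-zero homogeneous generators of $\mathcal I(P_M,Q_N)$. -/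

import Mathlib

open MvPolynomial

noncomputable section

/-- The projective plane over `K`, with homogeneous coordinates indexed by `0, 1, 2`. -/
abbrev ProjPlane (K : Type*) [Field K] : Type _ := Projectivization K (Fin 3 → K)

/-- The set `Δ₁` of points of the projective plane with at most two non-zero homogeneous
coordinates, that is, the union of the three coordinate lines. -/
def coordLines (K : Type*) [Field K] : Set (ProjPlane K) :=
  {p | ∃ i, p.rep i = 0}

/-- A projective line: the set of points of a two-dimensional linear subspace of `K³`. -/
def IsProjLine {K : Type*} [Field K] (L : Set (ProjPlane K)) : Prop :=
  ∃ W : Submodule K (Fin 3 → K), Module.finrank K W = 2 ∧ L = {p | p.submodule ≤ W}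

open Classical in
/-- The Hadamard product `p ⋆ q = [p₀q₀ : p₁q₁ : p₂q₂]` of two points, with the value `none`
("not defined") if all the products `pᵢqᵢ` vanish. -/
def hadamardPoint {K : Type*} [Field K] (p q : ProjPlane K) : Option (ProjPlane K) :=
  if h : (fun i => p.rep i * q.rep i) ≠ 0 then some (Projectivization.mk K _ h) else none

/-- The set `p ⋆ L` of all Hadamard products of the point `p` with points of `L`. If `p` has no zero
coordinate and `L` is a line, this is a line too, so that it is already closed. -/
def hadamardSet {K : Type*} [Field K] (p : ProjPlane K) (L : Set (ProjPlane K)) :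
    Set (ProjPlane K) :=
  {x | ∃ q ∈ L, hadamardPoint p q = some x}

/-- The ideal `I(p)` generated by all homogeneous polynomials that vanish at the point `p`. -/
def pointIdeal {K : Type*} [Field K] (p : ProjPlane K) : Ideal (MvPolynomial (Fin 3) K) :=
  Ideal.span {f | (∃ d : ℕ, f.IsHomogeneous d) ∧ eval p.rep f = 0}

/-- The ideal `I(p₁)^{m₁} ∩ ⋯ ∩ I(pₖ)^{mₖ}` of the set of fat points `m₁p₁ + ⋯ + mₖpₖ`. -/
def fatPointsIdeal {K : Type*} [Field K] {k : ℕ} (p : Fin k → ProjPlane K) (m : Fin k → ℕ) :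
    Ideal (MvPolynomial (Fin 3) K) :=
  ⨅ i, pointIdeal (p i) ^ m i

/-- The Hadamard product `I ⋆ J` of two ideals of `K[x]`: the elimination ideal
`(I(y) + J(z) + ⟨xᵢ - yᵢzᵢ⟩) ∩ K[x]`, computed in the polynomial ring `K[x, y, z]`, whose variables
`xᵢ`, `yᵢ`, `zᵢ` are indexed by the three summands of `σ ⊕ (σ ⊕ σ)`. -/
def hadamardIdeal {K σ : Type*} [Field K] (I J : Ideal (MvPolynomial σ K)) :
    Ideal (MvPolynomial σ K) :=
  Ideal.comap (rename (R := K) (Sum.inl : σ → σ ⊕ (σ ⊕ σ)))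
    (Ideal.map (rename (R := K) (fun i : σ => (Sum.inr (Sum.inl i) : σ ⊕ (σ ⊕ σ)))) I ⊔
      Ideal.map (rename (R := K) (fun i : σ => (Sum.inr (Sum.inr i) : σ ⊕ (σ ⊕ σ)))) J ⊔
      Ideal.span (Set.range fun i : σ =>
        (X (Sum.inl i) - X (Sum.inr (Sum.inl i)) * X (Sum.inr (Sum.inr i)) :
          MvPolynomial (σ ⊕ (σ ⊕ σ)) K)))

/-- `P₁, …, Pᵣ` and `Q₁, …, Qₛ` are two families of collinear points with no zero coordinate whose
Hadamard products `Pᵢ ⋆ Qⱼ` form an `(r, s)`-grid: these `rs` points are distinct, and `Pᵢ ⋆ Qⱼ` is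
the intersection of two different lines `Pᵢ ⋆ ℓ_Q` and `ℓ_P ⋆ Qⱼ`, where `ℓ_P` and `ℓ_Q` are lines
through the `Pᵢ` and through the `Qⱼ`. -/
structure IsHadamardGrid {K : Type*} [Field K] {r s : ℕ}
    (P : Fin r → ProjPlane K) (Q : Fin s → ProjPlane K) : Prop where
  left_notMem : ∀ i, P i ∉ coordLines K
  right_notMem : ∀ j, Q j ∉ coordLines K
  injective : Function.Injective fun ij : Fin r × Fin s => hadamardPoint (P ij.1) (Q ij.2)
  lines : ∃ LP LQ : Set (ProjPlane K), IsProjLine LP ∧ IsProjLine LQ ∧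
    (∀ i, P i ∈ LP) ∧ (∀ j, Q j ∈ LQ) ∧
    ∀ i j, hadamardSet (P i) LQ ≠ hadamardSet (Q j) LP

/-- The ideal `I(P_M) ⋆ I(Q_N)` of the Hadamard fat grid `HFG(P_M, Q_N)`. -/
def hadamardFatGridIdeal {K : Type*} [Field K] {r s : ℕ}
    (P : Fin r → ProjPlane K) (m : Fin r → ℕ) (Q : Fin s → ProjPlane K) (n : Fin s → ℕ) :
    Ideal (MvPolynomial (Fin 3) K) :=
  hadamardIdeal (fatPointsIdeal P m) (fatPointsIdeal Q n)

/-- `a = α(I)`: the least degree `d` such that the component `I_d` is not zero. -/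
def IsInitialDegree {K σ : Type*} [Field K] (I : Ideal (MvPolynomial σ K)) (a : ℕ) : Prop :=
  IsLeast {d : ℕ | ∃ f ∈ I, f.IsHomogeneous d ∧ f ≠ 0} a

end

/-! The value is squeezed between a Bézout-type lower bound and an explicit product of lines. Both
rest on the link between the Hadamard ideal and multiplicity `m i + n j - 1` at `P i ⋆ Q j`.

Lower bound. The derivation `x_i ∂/∂x_i` lifts to `K[x, y, z]` as `x_i ∂/∂x_i + y_i ∂/∂y_i`, which
respects the relations `x = yz`, lowers a power of `I(y)` by at most one and kills polynomials in
`z`. So `X i * pderiv i` maps `I ^ (a + 1) ⋆ J` into `I ^ a ⋆ J` (`X_mul_pderiv_mem_hadamardIdeal`),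
and likewise on the other side. In characteristic 0, away from the coordinate lines, these operators
detect multiplicity, whence `X_pow_dvd_germ_of_mem_hadamardIdeal`. Now keep only `r` columns of
largest `n`. In this `r × r` grid a form of degree `d` has total multiplicity at most `r * d`
(`sum_multiplicity_le_card_mul`): either no row line is a component and every row sum is at most
`d`, or a row line splits off, which costs at most one at each of its `r` points. The total of `m i
+ n j - 1` is `r` times the claimed degree.

Upper bound. Let `c` be the `r`-th largest `n`. Take the row lines to the powers `m i - 1 + c` and
the column lines to the powers `n j - c`, truncated at 0 (`IsHadamardGrid.exists_form`). Membership
is checked after `x_i ↦ x_i ⊗ x_i`. Over a field, intersections commute with forming `I ⊗ B + A ⊗ J`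
(`mem_tensorIdeal_iInf`), so one grid point can be treated at a time, where `(I ⊗ B + A ⊗ J) ^ (a +
b + 1)` lies in `I ^ (a + 1) ⊗ B + A ⊗ J ^ (b + 1)`. -/

/-- The expansion `F(p + T X)` of `F` at the point `p`, as a polynomial in `T`. Divisibility of
`germ p F` by `T ^ k` says that `F` has multiplicity at least `k` at `p`. -/
noncomputable def germ {K σ : Type*} [Field K] (p : σ → K) :
    MvPolynomial σ K →ₐ[K] Polynomial (MvPolynomial σ K) :=
  aeval fun i => Polynomial.C (C (p i)) + Polynomial.X * Polynomial.C (X i)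

/-- The linear form with coefficient vector `l`. -/
noncomputable def linForm {K σ : Type*} [Field K] [Fintype σ] (l : σ → K) : MvPolynomial σ K :=
  ∑ i, C (l i) * X i

/-! ### Multiplicity of a polynomial at a point, and linear forms. -/

section Germ

variable {K σ : Type*} [Field K]

theorem germ_X (p : σ → K) (i : σ) :
    germ p (X i) = Polynomial.C (C (p i)) + Polynomial.X * Polynomial.C (X i) := by
  simp [germ]

theorem germ_C (p : σ → K) (a : K) : germ p (C a) = Polynomial.C (C a) := by
  rw [← MvPolynomial.algebraMap_eq, AlgHom.commutes]
  rfl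

theorem coeff_zero_germ (p : σ → K) (F : MvPolynomial σ K) :
    (germ p F).coeff 0 = C (eval p F) := by
  have h : ((Polynomial.constantCoeff (R := MvPolynomial σ K)).comp (germ p).toRingHom) =
      (C (σ := σ)).comp (eval p) := by
    refine MvPolynomial.ringHom_ext (fun a => ?_) fun i => ?_
    · simp
    · simp [germ_X]
  exact congrArg (fun φ : MvPolynomial σ K →+* MvPolynomial σ K => φ F) h

theorem derivative_germ [Fintype σ] (p : σ → K) (F : MvPolynomial σ K) :
    Polynomial.derivative (germ p F) = ∑ i, Polynomial.C (X i) * germ p (pderiv i F) := by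
  classical
  induction F using MvPolynomial.induction_on with
  | C a => simp
  | add f g hf hg => simp [hf, hg, mul_add, Finset.sum_add_distrib]
  | mul_X f j hf =>
    have h1 : ∀ i, Polynomial.C (X i) * germ p (pderiv i (f * X j)) =
        Polynomial.C (X i) * germ p (pderiv i f) * germ p (X j) +
          if i = j then Polynomial.C (X i) * germ p f else 0 := by
      intro i
      by_cases h : i = j
      · subst h
        simp
        ring
      · simp [pderiv_X_of_ne (Ne.symm h), h]
        ring
    simp only [h1, Finset.sum_add_distrib, ← Finset.sum_mul, ← hf, map_mul,
      Polynomial.derivative_mul]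
    simp [germ_X, -Polynomial.X_mul_C]
    ring

theorem X_not_dvd_germ {p : σ → K} {F : MvPolynomial σ K} (h : eval p F ≠ 0) :
    ¬ Polynomial.X ∣ germ p F := by
  rw [Polynomial.X_dvd_iff, coeff_zero_germ]
  simpa using h

theorem X_pow_dvd_germ_of_mul {p : σ → K} {F G : MvPolynomial σ K} {k : ℕ} (h : eval p F ≠ 0)
    (hd : Polynomial.X ^ k ∣ germ p (F * G)) : Polynomial.X ^ k ∣ germ p G := by
  rw [map_mul] at hd
  exact Polynomial.prime_X.pow_dvd_of_dvd_mul_left k (X_not_dvd_germ h) hd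

theorem X_pow_succ_dvd_of_derivative {R : Type*} [CommRing R] [IsDomain R] [CharZero R]
    {f : Polynomial R} {k : ℕ} (h0 : f.coeff 0 = 0)
    (h : Polynomial.X ^ k ∣ Polynomial.derivative f) : Polynomial.X ^ (k + 1) ∣ f := by
  rw [Polynomial.X_pow_dvd_iff] at h ⊢
  intro d hd
  cases d with
  | zero => exact h0
  | succ d =>
    have := h d (by omega)
    rw [Polynomial.coeff_derivative] at this
    exact (mul_eq_zero.1 this).resolve_right (by exact_mod_cast Nat.succ_ne_zero d)

/-- The Euler operators `X i * pderiv i` replace the plain partials because they are the ones that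
lift to the Hadamard graph; the factor `X i` is a unit near `p` and cancels. -/
theorem X_pow_succ_dvd_germ [Fintype σ] [CharZero K] {p : σ → K} {F : MvPolynomial σ K} {k : ℕ}
    (hp : ∀ i, p i ≠ 0) (h0 : eval p F = 0)
    (h : ∀ i, Polynomial.X ^ k ∣ germ p (X i * pderiv i F)) :
    Polynomial.X ^ (k + 1) ∣ germ p F := by
  refine X_pow_succ_dvd_of_derivative (by rw [coeff_zero_germ, h0, map_zero]) ?_
  rw [derivative_germ]
  exact Finset.dvd_sum fun i _ =>
    (X_pow_dvd_germ_of_mul (by simpa using hp i) (h i)).mul_left _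

/-- This identity is the working form of homogeneity: it passes to the cofactor of a linear form by
plain cancellation. -/
theorem germ_zero_of_isHomogeneous {F : MvPolynomial σ K} {d : ℕ} (h : F.IsHomogeneous d) :
    germ 0 F = Polynomial.X ^ d * Polynomial.C F := by
  rw [germ, aeval_def, eval₂_eq]
  conv_rhs => rw [F.as_sum, map_sum, Finset.mul_sum]
  refine Finset.sum_congr rfl fun e he => ?_
  have hd : ∑ i ∈ e.support, e i = d := by
    have := h (mem_support_iff.1 he)
    rwa [Finsupp.weight_apply, Finsupp.sum, Finset.sum_congr rfl (g := fun i => e i) (by simp)]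
      at this
  rw [monomial_eq, ← hd, ← Finset.prod_pow_eq_pow_sum]
  have hc : (algebraMap K (Polynomial (MvPolynomial σ K))) (coeff e F) =
    Polynomial.C (C (coeff e F)) := rfl
  simp only [hc, Pi.zero_apply, map_zero, zero_add, mul_pow, Finset.prod_mul_distrib, Finsupp.prod,
    map_mul, map_prod, map_pow]
  ring

theorem eval_smul_of_germ_zero {F : MvPolynomial σ K} {d : ℕ}
    (h : germ 0 F = Polynomial.X ^ d * Polynomial.C F) (t : K) (x : σ → K) :
    eval (t • x) F = t ^ d * eval x F := by
  have h1 : ((Polynomial.evalRingHom t).comp ((Polynomial.mapRingHom (eval x)).comp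
      (germ (0 : σ → K)).toRingHom)) = eval (t • x) := by
    refine MvPolynomial.ringHom_ext (fun a => ?_) fun i => ?_
    · simp
    · simp only [RingHom.comp_apply, AlgHom.toRingHom_eq_coe, RingHom.coe_coe, germ_X]
      simp [-Polynomial.X_mul_C]
  rw [← h1]
  simp [h, -Polynomial.X_mul_C]
  ring

variable [Fintype σ]

theorem eval_linForm (l v : σ → K) : eval v (linForm l) = ∑ i, l i * v i := by
  simp [linForm]

theorem linForm_isHomogeneous (l : σ → K) : (linForm l).IsHomogeneous 1 :=
  IsHomogeneous.sum _ _ _ fun i _ => isHomogeneous_C_mul_X (l i) i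

theorem coeff_linForm [DecidableEq σ] (l : σ → K) (i : σ) :
    coeff (Finsupp.single i 1) (linForm l) = l i := by
  simp [linForm, coeff_sum, coeff_C_mul, coeff_X, Finsupp.single_left_inj]

theorem linForm_ne_zero {l : σ → K} (hl : l ≠ 0) : linForm l ≠ 0 := by
  classical
  intro h
  apply hl
  ext i
  rw [← coeff_linForm l i, h]
  simp

theorem germ_linForm {l p : σ → K} (h : ∑ i, l i * p i = 0) :
    germ p (linForm l) = Polynomial.X * Polynomial.C (linForm l) := by
  have : Polynomial.C (C (∑ i, l i * p i) : MvPolynomial σ K) = 0 := by rw [h]; simp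
  rw [linForm, map_sum, map_sum, Finset.mul_sum]
  simp only [map_mul, germ_C, germ_X, mul_add, Finset.sum_add_distrib]
  simp only [map_sum, map_mul] at this
  rw [this, zero_add]
  refine Finset.sum_congr rfl fun i _ => ?_
  ring

theorem X_pow_dvd_germ_of_linForm_mul {l p : σ → K} (hl : l ≠ 0) (h : ∑ i, l i * p i = 0)
    {F : MvPolynomial σ K} {k : ℕ} (hd : Polynomial.X ^ k ∣ germ p (linForm l * F)) :
    Polynomial.X ^ (k - 1) ∣ germ p F := by
  cases k with
  | zero => simp
  | succ k =>
    rw [map_mul, germ_linForm h, pow_succ', mul_assoc,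
      mul_dvd_mul_iff_left Polynomial.X_ne_zero] at hd
    refine Polynomial.prime_X.pow_dvd_of_dvd_mul_left k ?_ hd
    rw [Polynomial.X_dvd_iff, Polynomial.coeff_C_zero]
    exact linForm_ne_zero hl

theorem germ_zero_of_linForm_mul {l : σ → K} (hl : l ≠ 0) {F : MvPolynomial σ K} {d : ℕ}
    (h : germ 0 (linForm l * F) = Polynomial.X ^ (d + 1) * Polynomial.C (linForm l * F)) :
    germ 0 F = Polynomial.X ^ d * Polynomial.C F := by
  rw [map_mul, germ_linForm (by simp), map_mul] at h
  have h0 : Polynomial.X * Polynomial.C (linForm l) ≠ 0 :=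
    mul_ne_zero Polynomial.X_ne_zero (by simpa using linForm_ne_zero hl)
  refine mul_left_cancel₀ h0 ?_
  rw [h]
  ring

theorem totalDegree_linForm {l : σ → K} (hl : l ≠ 0) : (linForm l).totalDegree = 1 :=
  (linForm_isHomogeneous l).totalDegree (linForm_ne_zero hl)

/-- A polynomial vanishing on the part of a hyperplane where some form `e` is non-zero is divisible
by the equation of the hyperplane, if `e` does not vanish identically on the hyperplane. -/
theorem linForm_dvd_of_eval_eq_zero [Infinite K] {l u : σ → K} (hl : l ≠ 0)
    {F E : MvPolynomial σ K} (hu : ∑ i, l i * u i = 0) (hE : eval u E ≠ 0)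
    (h : ∀ x : σ → K, ∑ i, l i * x i = 0 → eval x E ≠ 0 → eval x F = 0) : linForm l ∣ F := by
  classical
  obtain ⟨k, hk⟩ := Function.ne_iff.1 hl
  let v : σ → K := Pi.single k (l k)⁻¹
  have hv : ∑ i, l i * v i = 1 := by
    rw [Finset.sum_eq_single k]
    · simp only [v, Pi.single_eq_same]
      exact mul_inv_cancel₀ hk
    · intro b _ hb
      simp [v, hb]
    · simp
  -- Composition with the projection onto the hyperplane along `v`. It changes nothing modulo
  -- `linForm l`, so divisibility follows once `ρ F = 0`.
  let ρ : MvPolynomial σ K →ₐ[K] MvPolynomial σ K := aeval fun i => X i - C (v i) * linForm l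
  have hρ : ∀ (x : σ → K) (G : MvPolynomial σ K),
      eval x (ρ G) = eval (fun i => x i - v i * ∑ j, l j * x j) G := by
    intro x G
    have : (eval x).comp ρ.toRingHom = eval (fun i => x i - v i * ∑ j, l j * x j) := by
      refine MvPolynomial.ringHom_ext (fun a => ?_) fun i => ?_
      · simp
      · simp [ρ, eval_linForm]
    exact congrArg (fun φ : MvPolynomial σ K →+* K => φ G) this
  have hker : ∀ x : σ → K, ∑ i, l i * (x i - v i * ∑ j, l j * x j) = 0 := by
    intro x
    simp only [mul_sub, Finset.sum_sub_distrib, ← mul_assoc, ← Finset.sum_mul, hv, one_mul,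
      sub_self]
  have hprod : ρ E * ρ F = 0 := by
    refine MvPolynomial.funext fun x => ?_
    rw [map_mul, hρ, hρ, map_zero]
    by_cases h0 : eval (fun i => x i - v i * ∑ j, l j * x j) E = 0
    · rw [h0, zero_mul]
    · rw [h _ (hker x) h0, mul_zero]
  have hE' : ρ E ≠ 0 := by
    intro h0
    apply hE
    have := hρ u E
    rw [h0, map_zero, hu] at this
    simpa using this.symm
  have hF : ρ F = 0 := (mul_eq_zero.1 hprod).resolve_left hE'
  have hmod : ∀ G : MvPolynomial σ K, linForm l ∣ G - ρ G := by
    intro G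
    have : (Ideal.Quotient.mkₐ K (Ideal.span {linForm l})).comp ρ =
        Ideal.Quotient.mkₐ K (Ideal.span {linForm l}) := by
      refine MvPolynomial.algHom_ext fun i => ?_
      simp only [AlgHom.comp_apply, Ideal.Quotient.mkₐ_eq_mk, ρ, aeval_X]
      rw [Ideal.Quotient.eq, Ideal.mem_span_singleton]
      exact ⟨-C (v i), by ring⟩
    have h2 := congrArg (fun φ : MvPolynomial σ K →ₐ[K] _ => φ G) this
    simp only [AlgHom.comp_apply, Ideal.Quotient.mkₐ_eq_mk] at h2
    rw [← Ideal.mem_span_singleton, ← Ideal.Quotient.eq]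
    exact h2.symm
  simpa [hF] using hmod F

end Germ

/-! ### Bézout for a line and a curve, and the degree bound on a grid. -/

section Plane

variable {K : Type*} [Field K]

theorem exists_line_direction {l a : Fin 3 → K} (hl : l ≠ 0) (ha : ∑ i, l i * a i = 0)
    (ha0 : a 0 = 1) : ∃ w : Fin 3 → K,
      ∀ x : Fin 3 → K, ∑ i, l i * x i = 0 → ∃ c : K, x = x 0 • a + c • w := by
  simp only [Fin.sum_univ_three] at ha ⊢
  rw [ha0, mul_one] at ha
  have hne : l 1 ≠ 0 ∨ l 2 ≠ 0 := by
    by_contra! h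
    apply hl
    ext i
    fin_cases i
    · simpa [h] using ha
    · exact h.1
    · exact h.2
  -- The direction is the point of the line at infinity, `x 0 = 0`.
  refine ⟨![0, l 2, -l 1], fun x hx => ?_⟩
  · rcases hne with h | h
    · refine ⟨-(x 2 - x 0 * a 2) / l 1, ?_⟩
      ext i
      fin_cases i
      · simp [ha0]
      · simp
        field_simp
        linear_combination hx - x 0 * ha
      · simp
        field_simp
        ring
    · refine ⟨(x 1 - x 0 * a 1) / l 2, ?_⟩
      ext i
      fin_cases i
      · simp [ha0]
      · simp
        field_simp
        ring
      · simp
        field_simp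
        linear_combination hx - x 0 * ha

/-- The restriction of a polynomial to the line `a + t w`. -/
noncomputable def lineRestrict (a w : Fin 3 → K) : MvPolynomial (Fin 3) K →ₐ[K] Polynomial K :=
  aeval fun i => Polynomial.C (a i) + Polynomial.X * Polynomial.C (w i)

theorem lineRestrict_X (a w : Fin 3 → K) (i : Fin 3) :
    lineRestrict a w (X i) = Polynomial.C (a i) + Polynomial.X * Polynomial.C (w i) := by
  simp [lineRestrict]

theorem eval_lineRestrict (a w : Fin 3 → K) (F : MvPolynomial (Fin 3) K) (t : K) :
    (lineRestrict a w F).eval t = eval (a + t • w) F := by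
  have : (Polynomial.evalRingHom t).comp (lineRestrict a w).toRingHom = eval (a + t • w) := by
    refine MvPolynomial.ringHom_ext (fun b => ?_) fun i => ?_
    · simp
    · simp only [RingHom.comp_apply, AlgHom.toRingHom_eq_coe, RingHom.coe_coe, lineRestrict_X]
      simp [-Polynomial.X_mul_C]
  exact congrArg (fun φ : MvPolynomial (Fin 3) K →+* K => φ F) this

theorem natDegree_lineRestrict_le (a w : Fin 3 → K) {F : MvPolynomial (Fin 3) K} {d : ℕ}
    (hdeg : F.totalDegree ≤ d) : (lineRestrict a w F).natDegree ≤ d := by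
  have := aeval_natDegree_le (m := d) (n := 1) F hdeg
    (fun i => Polynomial.C (a i) + Polynomial.X * Polynomial.C (w i)) fun i => by
      refine (Polynomial.natDegree_add_le _ _).trans (max_le (by simp) ?_)
      exact (Polynomial.natDegree_mul_C_le _ _).trans Polynomial.natDegree_X_le
  rwa [mul_one] at this

theorem pow_dvd_lineRestrict (a w : Fin 3 → K) {F : MvPolynomial (Fin 3) K} {c : K} {k : ℕ}
    (hk : Polynomial.X ^ k ∣ germ (a + c • w) F) :
    (Polynomial.X - Polynomial.C c) ^ k ∣ lineRestrict a w F := by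
  -- Substituting `T ↦ t - c` and `X ↦ w` in `F(a + c w + T X)` gives `F(a + t w)`.
  let ψ : Polynomial (MvPolynomial (Fin 3) K) →+* Polynomial K :=
    Polynomial.eval₂RingHom (Polynomial.C.comp (eval w)) (Polynomial.X - Polynomial.C c)
  have hψ : ψ (germ (a + c • w) F) = lineRestrict a w F := by
    have : ψ.comp (germ (a + c • w)).toRingHom = (lineRestrict a w).toRingHom := by
      refine MvPolynomial.ringHom_ext (fun b => ?_) fun i => ?_
      · simp [ψ]
      · simp only [RingHom.comp_apply, AlgHom.toRingHom_eq_coe, RingHom.coe_coe, germ_X,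
          lineRestrict_X]
        simp [ψ, -Polynomial.X_mul_C]
        ring
    exact congrArg (fun φ : MvPolynomial (Fin 3) K →+* Polynomial K => φ F) this
  have := map_dvd ψ hk
  rw [hψ, map_pow] at this
  simpa [ψ] using this

/-- A line meets a curve `F = 0` not containing it in at most `deg F` points, counted with
multiplicity. -/
theorem sum_multiplicity_le_of_not_dvd [Infinite K] {κ : Type*} [Fintype κ] {l : Fin 3 → K}
    (hl : l ≠ 0) {v : κ → Fin 3 → K} (hv0 : ∀ j, v j 0 = 1) (hv : ∀ j, ∑ i, l i * v j i = 0)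
    (hinj : Function.Injective v) {F : MvPolynomial (Fin 3) K} {d : ℕ}
    (hF : germ 0 F = Polynomial.X ^ d * Polynomial.C F) (hdeg : F.totalDegree ≤ d)
    (hnd : ¬ linForm l ∣ F) {k : κ → ℕ} (hk : ∀ j, Polynomial.X ^ k j ∣ germ (v j) F) :
    ∑ j, k j ≤ d := by
  rcases isEmpty_or_nonempty κ with _ | ⟨⟨j₀⟩⟩
  · simp
  obtain ⟨w, hx⟩ := exists_line_direction hl (hv j₀) (hv0 j₀)
  choose c hc using fun j => hx (v j) (hv j)
  simp only [hv0, one_smul] at hc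
  have hg0 : lineRestrict (v j₀) w F ≠ 0 := by
    intro h0
    -- The parametrization reaches only points with `x 0 = 1`; homogeneity extends the vanishing to
    -- `x 0 ≠ 0`, which is dense in the line.
    refine hnd (linForm_dvd_of_eval_eq_zero hl (E := X 0) (hv j₀) (by simp [hv0]) ?_)
    intro x hlx hx0
    rw [eval_X] at hx0
    obtain ⟨b, hb⟩ := hx x hlx
    have : x = x 0 • (v j₀ + (b / x 0) • w) := by
      rw [smul_add, smul_smul, mul_div_cancel₀ b hx0]
      exact hb
    rw [this, eval_smul_of_germ_zero hF, ← eval_lineRestrict, h0]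
    simp
  have hcinj : Function.Injective c := by
    intro j j' h
    apply hinj
    rw [hc j, hc j', h]
  have hprod : ∏ j, (Polynomial.X - Polynomial.C (c j)) ^ k j ∣ lineRestrict (v j₀) w F := by
    refine Finset.prod_dvd_of_coprime
      (fun i _ j _ hij => (Polynomial.pairwise_coprime_X_sub_C hcinj hij).pow) fun j _ => ?_
    refine pow_dvd_lineRestrict _ _ ?_
    rw [← hc j]
    exact hk j
  have hle := Polynomial.natDegree_le_of_dvd hprod hg0
  rw [Polynomial.natDegree_prod_of_monic _ _
    fun j _ => (Polynomial.monic_X_sub_C (c j)).pow (k j)] at hle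
  simp only [Polynomial.natDegree_pow, Polynomial.natDegree_X_sub_C, mul_one] at hle
  exact hle.trans (natDegree_lineRestrict_le _ _ hdeg)

/-- Degree bound for a curve with given multiplicities at the points `v i j` of a grid with at most
as many columns as rows, whose `i`-th row lies on the line `l i`. -/
theorem sum_multiplicity_le_card_mul [Infinite K] {ι κ : Type*} [Fintype ι] [Fintype κ]
    (hcard : Fintype.card κ ≤ Fintype.card ι) {l : ι → Fin 3 → K} (hl : ∀ i, l i ≠ 0)
    {v : ι → κ → Fin 3 → K} (hv0 : ∀ i j, v i j 0 = 1)
    (hv : ∀ i j, ∑ t, l i t * v i j t = 0)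
    (hne : ∀ i i' j, i ≠ i' → ∑ t, l i t * v i' j t ≠ 0)
    (hinj : ∀ i, Function.Injective (v i)) {d : ℕ} :
    ∀ {F : MvPolynomial (Fin 3) K}, F ≠ 0 → germ 0 F = Polynomial.X ^ d * Polynomial.C F →
      F.totalDegree ≤ d → ∀ {k : ι → κ → ℕ},
      (∀ i j, Polynomial.X ^ k i j ∣ germ (v i j) F) →
      ∑ i, ∑ j, k i j ≤ Fintype.card ι * d := by
  classical
  induction d with
  | zero =>
    intro F hF0 hF hdeg k hk
    refine Finset.sum_le_card_nsmul _ _ 0 fun i _ => ?_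
    refine sum_multiplicity_le_of_not_dvd (hl i) (hv0 i) (hv i) (hinj i) hF hdeg ?_ (hk i)
    rintro ⟨G, rfl⟩
    rw [totalDegree_mul_of_isDomain (linForm_ne_zero (hl i)) (right_ne_zero_of_mul hF0),
      totalDegree_linForm (hl i)] at hdeg
    omega
  | succ d ih =>
    intro F hF0 hF hdeg k hk
    by_cases hdvd : ∃ i, linForm (l i) ∣ F
    · obtain ⟨i, G, rfl⟩ := hdvd
      have hG0 := right_ne_zero_of_mul hF0
      rw [totalDegree_mul_of_isDomain (linForm_ne_zero (hl i)) hG0,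
        totalDegree_linForm (hl i)] at hdeg
      -- Dividing by the `i`-th line lowers multiplicities by at most one on row `i`, and not at all
      -- on the other rows, which avoid that line. The total falls by at most `card κ ≤ card ι`.
      have := ih hG0 (germ_zero_of_linForm_mul (hl i) hF) (by omega)
        (k := fun i' j => if i' = i then k i' j - 1 else k i' j) (by
          intro i' j
          split_ifs with h
          · subst h
            exact X_pow_dvd_germ_of_linForm_mul (hl i') (hv i' j) (hk i' j)
          · refine X_pow_dvd_germ_of_mul ?_ (hk i' j)
            rw [eval_linForm]
            exact hne i i' j (Ne.symm h))
      calc ∑ i', ∑ j, k i' j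
          ≤ ∑ i', ∑ j, ((if i' = i then k i' j - 1 else k i' j) + if i' = i then 1 else 0) := by
            refine Finset.sum_le_sum fun i' _ => Finset.sum_le_sum fun j _ => ?_
            split_ifs <;> omega
        _ ≤ Fintype.card ι * d + Fintype.card κ := by
            simp only [Finset.sum_add_distrib]
            refine add_le_add this ?_
            simp
        _ ≤ Fintype.card ι * (d + 1) := by rw [mul_add, mul_one]; omega
    · push Not at hdvd
      exact Finset.sum_le_card_nsmul _ _ (d + 1) fun i _ =>
        sum_multiplicity_le_of_not_dvd (hl i) (hv0 i) (hv i) (hinj i) hF hdeg (hdvd i) (hk i)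

end Plane

/-! ### Derivations on the Hadamard graph, and multiplicities of its elements. -/

section HadamardIdeal

theorem Derivation.mem_pow_of_mem_pow_succ {R B : Type*} [CommRing R] [CommRing B] [Algebra R B]
    (D : Derivation R B B) (I : Ideal B) (a : ℕ) {f : B} (hf : f ∈ I ^ (a + 1)) :
    D f ∈ I ^ a := by
  induction a generalizing f with
  | zero => simp
  | succ a ih =>
    rw [pow_succ] at hf
    refine Submodule.mul_induction_on hf (fun x hx y hy => ?_) fun x y hx hy => ?_
    · rw [Derivation.leibniz, smul_eq_mul, smul_eq_mul]
      refine add_mem (Ideal.mul_mem_right _ _ hx) ?_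
      rw [pow_succ']
      exact Ideal.mul_mem_mul hy (ih hx)
    · rw [map_add]
      exact add_mem hx hy

theorem Derivation.mem_span_of_mem_span {R B : Type*} [CommRing R] [CommRing B] [Algebra R B]
    (D : Derivation R B B) {s : Set B} (h : ∀ g ∈ s, D g ∈ Ideal.span s) {f : B}
    (hf : f ∈ Ideal.span s) : D f ∈ Ideal.span s := by
  induction hf using Submodule.span_induction with
  | mem g hg => exact h g hg
  | zero => simp
  | add x y _ _ hx hy =>
    rw [map_add]
    exact add_mem hx hy
  | smul b x hx hDx =>
    rw [smul_eq_mul, Derivation.leibniz, smul_eq_mul, smul_eq_mul]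
    exact add_mem (Ideal.mul_mem_left _ _ hDx) (Ideal.mul_mem_right _ _ hx)

theorem derivation_algHom_apply {K σ B : Type*} [CommRing K] [CommRing B] [Algebra K B]
    (φ : MvPolynomial σ K →ₐ[K] B) (D : Derivation K B B)
    (E : Derivation K (MvPolynomial σ K) (MvPolynomial σ K))
    (h : ∀ i, D (φ (X i)) = φ (E (X i))) (F : MvPolynomial σ K) : D (φ F) = φ (E F) := by
  induction F using MvPolynomial.induction_on with
  | C a =>
    rw [← MvPolynomial.algebraMap_eq, AlgHom.commutes, Derivation.map_algebraMap,
      Derivation.map_algebraMap, map_zero]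
  | add f g hf hg => simp [hf, hg]
  | mul_X f i hf => simp [Derivation.leibniz, hf, h]

variable {K σ : Type*} [Field K]

/-- The ideal `I(y) + J(z) + ⟨xᵢ - yᵢzᵢ⟩` of `K[x, y, z]`. -/
noncomputable def hadamardGraphIdeal (I J : Ideal (MvPolynomial σ K)) :
    Ideal (MvPolynomial (σ ⊕ (σ ⊕ σ)) K) :=
  Ideal.map (rename (R := K) (fun i : σ => (Sum.inr (Sum.inl i) : σ ⊕ (σ ⊕ σ)))) I ⊔
    Ideal.map (rename (R := K) (fun i : σ => (Sum.inr (Sum.inr i) : σ ⊕ (σ ⊕ σ)))) J ⊔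
    Ideal.span (Set.range fun i : σ =>
      (X (Sum.inl i) - X (Sum.inr (Sum.inl i)) * X (Sum.inr (Sum.inr i)) :
        MvPolynomial (σ ⊕ (σ ⊕ σ)) K))

theorem mem_hadamardIdeal {I J : Ideal (MvPolynomial σ K)} {F : MvPolynomial σ K} :
    F ∈ hadamardIdeal I J ↔ rename Sum.inl F ∈ hadamardGraphIdeal I J :=
  Iff.rfl

theorem hadamardIdeal_mono {I I' J J' : Ideal (MvPolynomial σ K)} (hI : I ≤ I') (hJ : J ≤ J') :
    hadamardIdeal I J ≤ hadamardIdeal I' J' :=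
  Ideal.comap_mono (sup_le_sup (sup_le_sup (Ideal.map_mono hI) (Ideal.map_mono hJ)) le_rfl)

theorem mem_hadamardIdeal_comm {I J : Ideal (MvPolynomial σ K)} {F : MvPolynomial σ K}
    (hF : F ∈ hadamardIdeal I J) : F ∈ hadamardIdeal J I := by
  let e : MvPolynomial (σ ⊕ (σ ⊕ σ)) K →ₐ[K] MvPolynomial (σ ⊕ (σ ⊕ σ)) K :=
    rename (Sum.map id Sum.swap)
  have hle : hadamardGraphIdeal I J ≤ (hadamardGraphIdeal J I).comap e := by
    refine sup_le (sup_le ?_ ?_) ?_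
    · rw [Ideal.map_le_iff_le_comap]
      intro f hf
      rw [Ideal.mem_comap, Ideal.mem_comap]
      simp only [e, rename_rename]
      exact Ideal.mem_sup_left (Ideal.mem_sup_right (Ideal.mem_map_of_mem _ hf))
    · rw [Ideal.map_le_iff_le_comap]
      intro f hf
      rw [Ideal.mem_comap, Ideal.mem_comap]
      simp only [e, rename_rename]
      exact Ideal.mem_sup_left (Ideal.mem_sup_left (Ideal.mem_map_of_mem _ hf))
    · rw [Ideal.span_le]
      rintro _ ⟨i, rfl⟩
      refine Ideal.mem_sup_right (Ideal.subset_span ⟨i, ?_⟩)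
      simp [e, mul_comm]
  have := hle (mem_hadamardIdeal.1 hF)
  rw [Ideal.mem_comap] at this
  simp only [e, rename_rename] at this
  exact this

/-- The graph ideal vanishes at the point `(pq, p, q)`. -/
theorem eval_eq_zero_of_mem_hadamardIdeal {I J : Ideal (MvPolynomial σ K)} {p q : σ → K}
    (hI : ∀ f ∈ I, eval p f = 0) (hJ : ∀ f ∈ J, eval q f = 0) {F : MvPolynomial σ K}
    (hF : F ∈ hadamardIdeal I J) : eval (p * q) F = 0 := by
  have hle : hadamardGraphIdeal I J ≤ RingHom.ker (eval (Sum.elim (p * q) (Sum.elim p q))) := by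
    refine sup_le (sup_le ?_ ?_) ?_
    · rw [Ideal.map_le_iff_le_comap]
      intro f hf
      rw [Ideal.mem_comap, RingHom.mem_ker, eval_rename]
      exact hI f hf
    · rw [Ideal.map_le_iff_le_comap]
      intro f hf
      rw [Ideal.mem_comap, RingHom.mem_ker, eval_rename]
      exact hJ f hf
    · rw [Ideal.span_le]
      rintro _ ⟨i, rfl⟩
      simp
  have := hle (mem_hadamardIdeal.1 hF)
  rw [RingHom.mem_ker, eval_rename] at this
  exact this

theorem X_mul_pderiv_mem_hadamardIdeal {I J : Ideal (MvPolynomial σ K)} {a : ℕ} (i : σ)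
    {F : MvPolynomial σ K} (hF : F ∈ hadamardIdeal (I ^ (a + 1)) J) :
    X i * pderiv i F ∈ hadamardIdeal (I ^ a) J := by
  classical
  -- `D = x_i ∂/∂x_i + y_i ∂/∂y_i` fixes `x_i - y_i z_i` and kills the other relations. Putting the
  -- weight on `y` alone leaves `J(z)` untouched while `I(y)` loses one power.
  let D : Derivation K (MvPolynomial (σ ⊕ (σ ⊕ σ)) K) (MvPolynomial (σ ⊕ (σ ⊕ σ)) K) :=
    mkDerivation K (Sum.elim (fun j => if j = i then X (Sum.inl j) else 0)
      (Sum.elim (fun j => if j = i then X (Sum.inr (Sum.inl j)) else 0) 0))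
  have hD : ∀ f ∈ hadamardGraphIdeal (I ^ (a + 1)) J, D f ∈ hadamardGraphIdeal (I ^ a) J := by
    intro f hf
    obtain ⟨f₁₂, hf₁₂, f₃, hf₃, rfl⟩ := Submodule.mem_sup.1 hf
    obtain ⟨f₁, hf₁, f₂, hf₂, rfl⟩ := Submodule.mem_sup.1 hf₁₂
    rw [map_add, map_add]
    refine add_mem (add_mem ?_ ?_) ?_
    · refine Ideal.mem_sup_left (Ideal.mem_sup_left ?_)
      rw [Ideal.map_pow] at hf₁ ⊢
      exact D.mem_pow_of_mem_pow_succ _ a hf₁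
    · refine Ideal.mem_sup_left (Ideal.mem_sup_right ?_)
      refine D.mem_span_of_mem_span ?_ hf₂
      rintro _ ⟨g, -, rfl⟩
      have := derivation_algHom_apply
        (rename (R := K) (fun i : σ => (Sum.inr (Sum.inr i) : σ ⊕ (σ ⊕ σ)))) D 0
        (fun j => by simp [D, mkDerivation_X]) g
      change D (rename (R := K) _ g) ∈ _
      rw [this]
      simp
    · refine Ideal.mem_sup_right (D.mem_span_of_mem_span ?_ hf₃)
      rintro _ ⟨j, rfl⟩
      by_cases h : j = i
      · have : D (X (Sum.inl j) - X (Sum.inr (Sum.inl j)) * X (Sum.inr (Sum.inr j))) =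
            X (Sum.inl j) - X (Sum.inr (Sum.inl j)) * X (Sum.inr (Sum.inr j)) := by
          simp [D, mkDerivation_X, Derivation.leibniz, h, mul_comm]
        dsimp only
        rw [this]
        exact Ideal.subset_span ⟨j, rfl⟩
      · have : D (X (Sum.inl j) - X (Sum.inr (Sum.inl j)) * X (Sum.inr (Sum.inr j))) = 0 := by
          simp [D, mkDerivation_X, Derivation.leibniz, h]
        dsimp only
        rw [this]
        exact zero_mem _
  have hcomm := derivation_algHom_apply (rename (R := K) (Sum.inl : σ → σ ⊕ (σ ⊕ σ))) D
    ((X i : MvPolynomial σ K) • pderiv i) (fun j => by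
      by_cases h : j = i
      · simp [D, mkDerivation_X, h]
      · simp [D, mkDerivation_X, h, pderiv_X_of_ne h]) F
  rw [mem_hadamardIdeal]
  have := hD _ (mem_hadamardIdeal.1 hF)
  rw [hcomm] at this
  simpa using this

/-- Elements of `I(p)^(a+1) ⋆ I(q)^(b+1)` have multiplicity at least `a + b + 1` at `p ⋆ q`. -/
theorem X_pow_dvd_germ_of_mem_hadamardIdeal [Fintype σ] [CharZero K]
    {I J : Ideal (MvPolynomial σ K)} {p q : σ → K} (hp : ∀ i, p i ≠ 0) (hq : ∀ i, q i ≠ 0)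
    (hI : ∀ f ∈ I, eval p f = 0) (hJ : ∀ f ∈ J, eval q f = 0) (a b : ℕ) {F : MvPolynomial σ K}
    (hF : F ∈ hadamardIdeal (I ^ (a + 1)) (J ^ (b + 1))) :
    Polynomial.X ^ (a + b + 1) ∣ germ (p * q) F := by
  have hpq : ∀ i, (p * q) i ≠ 0 := fun i => mul_ne_zero (hp i) (hq i)
  have h0 : ∀ {a b : ℕ} {F : MvPolynomial σ K},
      F ∈ hadamardIdeal (I ^ (a + 1)) (J ^ (b + 1)) → eval (p * q) F = 0 := fun h =>
    eval_eq_zero_of_mem_hadamardIdeal hI hJ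
      (hadamardIdeal_mono (Ideal.pow_le_self (Nat.succ_ne_zero _))
        (Ideal.pow_le_self (Nat.succ_ne_zero _)) h)
  -- Each Euler operator lowers `a`, or `b` after exchanging the factors. The last unit of
  -- multiplicity is the vanishing at `p * q` when both exponents are 1.
  induction a generalizing F with
  | zero =>
    induction b generalizing F with
    | zero =>
      refine X_pow_succ_dvd_germ hpq (h0 hF) fun i => ?_
      simp
    | succ b ih =>
      rw [← add_assoc] at *
      refine X_pow_succ_dvd_germ hpq (h0 hF) fun i => ih ?_
      exact mem_hadamardIdeal_comm (X_mul_pderiv_mem_hadamardIdeal i (mem_hadamardIdeal_comm hF))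
  | succ a ih =>
    rw [show a + 1 + b + 1 = (a + b + 1) + 1 by ring]
    exact X_pow_succ_dvd_germ hpq (h0 hF) fun i => ih (X_mul_pderiv_mem_hadamardIdeal i hF)

end HadamardIdeal

/-! ### Ideals `I ⊗ B + A ⊗ J` and a membership criterion for Hadamard ideals. -/

section TensorIdeal

open scoped TensorProduct

variable {K A B : Type*} [Field K] [CommRing A] [Algebra K A] [CommRing B] [Algebra K B]

/-- The ideal `I ⊗ B + A ⊗ J` of `A ⊗ B`. -/
noncomputable def tensorIdeal (I : Ideal A) (J : Ideal B) : Ideal (A ⊗[K] B) :=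
  I.map (Algebra.TensorProduct.includeLeft : A →ₐ[K] A ⊗[K] B) ⊔
    J.map (Algebra.TensorProduct.includeRight : B →ₐ[K] A ⊗[K] B)

/-- Contraction of the second tensor factor with a linear functional. -/
noncomputable def tensorContract (A : Type*) [CommRing A] [Algebra K A] (φ : B →ₗ[K] K) :
    A ⊗[K] B →ₗ[A] A :=
  (TensorProduct.AlgebraTensorModule.rid K A A).toLinearMap ∘ₗ φ.baseChange A

theorem tensorContract_tmul (φ : B →ₗ[K] K) (a : A) (b : B) :
    tensorContract A φ (a ⊗ₜ b) = φ b • a := by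
  simp [tensorContract]

theorem tensorContract_mem {I : Ideal A} {J : Ideal B} {φ : B →ₗ[K] K} (hφ : ∀ b ∈ J, φ b = 0)
    {t : A ⊗[K] B} (ht : t ∈ tensorIdeal I J) : tensorContract A φ t ∈ I := by
  obtain ⟨t₁, ht₁, t₂, ht₂, rfl⟩ := Submodule.mem_sup.1 ht
  rw [map_add]
  refine add_mem ?_ ?_
  · change t₁ ∈ (I.map (algebraMap A (A ⊗[K] B))).restrictScalars A at ht₁
    rw [← Ideal.smul_top_eq_map] at ht₁
    refine Submodule.smul_induction_on ht₁ (fun r hr n _ => ?_) fun x y hx hy => ?_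
    · rw [map_smul, smul_eq_mul]
      exact I.mul_mem_right _ hr
    · rw [map_add]
      exact add_mem hx hy
  · change t₂ ∈ (J.map (Algebra.TensorProduct.includeRight : B →ₐ[K] A ⊗[K] B)).restrictScalars K
      at ht₂
    rw [Ideal.map_includeRight_eq] at ht₂
    obtain ⟨u, rfl⟩ := ht₂
    clear ht
    have : tensorContract A φ (LinearMap.lTensor A (J.restrictScalars K).subtype u) = 0 := by
      induction u using TensorProduct.induction_on with
      | zero => simp
      | tmul a b => simp [tensorContract_tmul, hφ b b.2]
      | add x y hx hy => rw [map_add, map_add, hx, hy, add_zero]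
    rw [this]
    exact I.zero_mem

/-- For a basis of `B ⧸ J` with coordinate functionals `φ k` and lifts `β k`, the element `t` equals
`∑ tensorContract A (φ k) t ⊗ β k` modulo `A ⊗ J`. With `tensorContract_mem` this turns membership
into a family of conditions on `I` alone, which is why intersections pass through. -/
theorem mem_tensorIdeal_of_tensorContract {I : Ideal A} {J : Ideal B} {t : A ⊗[K] B}
    (h : ∀ φ : B →ₗ[K] K, (∀ b ∈ J, φ b = 0) → tensorContract A φ t ∈ I) :
    t ∈ tensorIdeal I J := by
  let e := Module.Basis.ofVectorSpace K (B ⧸ J)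
  let θ : A ⊗[K] B →ₐ[A] A ⊗[K] (B ⧸ J) :=
    Algebra.TensorProduct.map (AlgHom.id A A) (Ideal.Quotient.mkₐ K J)
  choose β hβ using fun k => Ideal.Quotient.mk_surjective (e k)
  let φ := fun k => e.coord k ∘ₗ (Ideal.Quotient.mkₐ K J).toLinearMap
  have hφ : ∀ k, ∀ b ∈ J, φ k b = 0 := by
    intro k b hb
    simp [φ, Ideal.Quotient.eq_zero_iff_mem.2 hb]
  have hrepr : ∀ k, (e.baseChange A).repr (θ t) k = tensorContract A (φ k) t := by
    intro k
    have : (e.baseChange A).coord k ∘ₗ θ.toLinearMap = tensorContract A (φ k) := by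
      ext b
      simp [θ, φ, tensorContract_tmul]
    exact congrArg (fun f : A ⊗[K] B →ₗ[A] A => f t) this
  have hsum : θ t = θ (∑ k ∈ ((e.baseChange A).repr (θ t)).support,
      tensorContract A (φ k) t ⊗ₜ β k) := by
    conv_lhs => rw [← (e.baseChange A).linearCombination_repr (θ t),
      Finsupp.linearCombination_apply, Finsupp.sum]
    rw [map_sum]
    refine Finset.sum_congr rfl fun k _ => ?_
    rw [hrepr]
    simp [θ, hβ, TensorProduct.smul_tmul']
  have hker : t - ∑ k ∈ ((e.baseChange A).repr (θ t)).support,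
      tensorContract A (φ k) t ⊗ₜ β k ∈
        J.map (Algebra.TensorProduct.includeRight : B →ₐ[K] A ⊗[K] B) := by
    have := Algebra.TensorProduct.lTensor_ker (A := A) (Ideal.Quotient.mkₐ K J)
      (Ideal.Quotient.mkₐ_surjective K J)
    have hk : RingHom.ker (Ideal.Quotient.mkₐ K J) = J := by
      ext b
      rw [RingHom.mem_ker, Ideal.Quotient.mkₐ_eq_mk, Ideal.Quotient.eq_zero_iff_mem]
    rw [hk] at this
    rw [← this, RingHom.mem_ker, map_sub]
    exact sub_eq_zero.2 hsum
  have hleft : ∑ k ∈ ((e.baseChange A).repr (θ t)).support, tensorContract A (φ k) t ⊗ₜ β k ∈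
      I.map (Algebra.TensorProduct.includeLeft : A →ₐ[K] A ⊗[K] B) := by
    refine sum_mem fun k _ => ?_
    have := Ideal.mul_mem_right ((1 : A) ⊗ₜ[K] β k) _
      (Ideal.mem_map_of_mem (Algebra.TensorProduct.includeLeft : A →ₐ[K] A ⊗[K] B)
        (h (φ k) (hφ k)))
    simpa using this
  have := add_mem (Ideal.mem_sup_right hker) (Ideal.mem_sup_left hleft)
  rwa [sub_add_cancel] at this

theorem mem_tensorIdeal_iInf_left {ι : Type*} {I : ι → Ideal A} {J : Ideal B} {t : A ⊗[K] B}
    (h : ∀ i, t ∈ tensorIdeal (I i) J) : t ∈ tensorIdeal (⨅ i, I i) J :=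
  mem_tensorIdeal_of_tensorContract fun _ hφ =>
    (Submodule.mem_iInf _).2 fun i => tensorContract_mem hφ (h i)

theorem comm_mem_tensorIdeal {I : Ideal A} {J : Ideal B} {t : A ⊗[K] B}
    (h : t ∈ tensorIdeal I J) : Algebra.TensorProduct.comm K A B t ∈ tensorIdeal J I := by
  have hle : tensorIdeal I J ≤ (tensorIdeal J I).comap (Algebra.TensorProduct.comm K A B) := by
    refine sup_le ?_ ?_
    · rw [Ideal.map_le_iff_le_comap]
      intro f hf
      have := Ideal.mem_map_of_mem (Algebra.TensorProduct.includeRight : A →ₐ[K] B ⊗[K] A) hf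
      exact Ideal.mem_sup_right (by simpa using this)
    · rw [Ideal.map_le_iff_le_comap]
      intro f hf
      have := Ideal.mem_map_of_mem (Algebra.TensorProduct.includeLeft : B →ₐ[K] B ⊗[K] A) hf
      exact Ideal.mem_sup_left (by simpa using this)
  exact hle h

theorem mem_tensorIdeal_iInf {ι κ : Type*} {I : ι → Ideal A} {J : κ → Ideal B} {t : A ⊗[K] B}
    (h : ∀ i j, t ∈ tensorIdeal (I i) (J j)) : t ∈ tensorIdeal (⨅ i, I i) (⨅ j, J j) := by
  refine mem_tensorIdeal_iInf_left fun i => ?_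
  have := mem_tensorIdeal_iInf_left fun j => comm_mem_tensorIdeal (h i j)
  have h2 := comm_mem_tensorIdeal this
  rw [← Algebra.TensorProduct.comm_symm] at h2
  simpa using h2

/-- In the binomial expansion, exponents adding up to `m + n + 1` force at least `m + 1` on the left
or `n + 1` on the right. -/
theorem tensorIdeal_pow_le (I : Ideal A) (J : Ideal B) (m n : ℕ) :
    tensorIdeal I J ^ (m + n + 1) ≤ tensorIdeal (K := K) (I ^ (m + 1)) (J ^ (n + 1)) := by
  rw [tensorIdeal, tensorIdeal, Ideal.map_pow, Ideal.map_pow, ← Ideal.add_eq_sup,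
    ← Ideal.add_eq_sup, add_pow, Ideal.sum_eq_sup]
  refine Finset.sup_le fun i _ => ?_
  by_cases h : m + 1 ≤ i
  · exact Ideal.mul_le_left.trans
      (Ideal.mul_le_left.trans ((Ideal.pow_le_pow_right h).trans le_sup_left))
  · exact Ideal.mul_le_left.trans
      (Ideal.mul_le_right.trans ((Ideal.pow_le_pow_right (by omega)).trans le_sup_right))

theorem pow_mul_pow_mem_tensorIdeal {I : Ideal A} {J : Ideal B} {x y : A ⊗[K] B}
    (hx : x ∈ tensorIdeal I J) (hy : y ∈ tensorIdeal I J) {m n a b : ℕ} (h : m + n + 1 ≤ a + b) :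
    x ^ a * y ^ b ∈ tensorIdeal (I ^ (m + 1)) (J ^ (n + 1)) := by
  refine tensorIdeal_pow_le I J m n (Ideal.pow_le_pow_right h ?_)
  rw [pow_add]
  exact Ideal.mul_mem_mul (Ideal.pow_mem_pow hx a) (Ideal.pow_mem_pow hy b)

variable {σ : Type*}

/-- The coordinate map `xᵢ ↦ yᵢ zᵢ` of the Hadamard product. -/
noncomputable def hadamardComul (K σ : Type*) [Field K] :
    MvPolynomial σ K →ₐ[K] MvPolynomial σ K ⊗[K] MvPolynomial σ K :=
  aeval fun i => X i ⊗ₜ X i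

/-- Modulo the relations `x_i = y_i z_i`, a polynomial in `x` is its own comultiplication with the
tensor factors read as `y` and `z`. -/
theorem mem_hadamardIdeal_of_hadamardComul_mem {I J : Ideal (MvPolynomial σ K)}
    {F : MvPolynomial σ K} (h : hadamardComul K σ F ∈ tensorIdeal I J) :
    F ∈ hadamardIdeal I J := by
  let ψ : MvPolynomial σ K ⊗[K] MvPolynomial σ K →ₐ[K] MvPolynomial (σ ⊕ (σ ⊕ σ)) K :=
    Algebra.TensorProduct.productMap
      (rename (R := K) (fun i : σ => (Sum.inr (Sum.inl i) : σ ⊕ (σ ⊕ σ))))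
      (rename (R := K) (fun i : σ => (Sum.inr (Sum.inr i) : σ ⊕ (σ ⊕ σ))))
  let N : Ideal (MvPolynomial (σ ⊕ (σ ⊕ σ)) K) := Ideal.span (Set.range fun i : σ =>
      X (Sum.inl i) - X (Sum.inr (Sum.inl i)) * X (Sum.inr (Sum.inr i)))
  have hle : tensorIdeal I J ≤ (hadamardGraphIdeal I J).comap ψ := by
    refine sup_le ?_ ?_
    · rw [Ideal.map_le_iff_le_comap]
      intro f hf
      refine Ideal.mem_sup_left (Ideal.mem_sup_left ?_)
      have := Ideal.mem_map_of_mem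
        (rename (R := K) (fun i : σ => (Sum.inr (Sum.inl i) : σ ⊕ (σ ⊕ σ)))) hf
      simpa [ψ] using this
    · rw [Ideal.map_le_iff_le_comap]
      intro f hf
      refine Ideal.mem_sup_left (Ideal.mem_sup_right ?_)
      have := Ideal.mem_map_of_mem
        (rename (R := K) (fun i : σ => (Sum.inr (Sum.inr i) : σ ⊕ (σ ⊕ σ)))) hf
      simpa [ψ] using this
  have hmod : rename Sum.inl F - ψ (hadamardComul K σ F) ∈ N := by
    rw [← Ideal.Quotient.eq]
    have : (Ideal.Quotient.mkₐ K N).comp (rename Sum.inl) =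
        (Ideal.Quotient.mkₐ K N).comp (ψ.comp (hadamardComul K σ)) := by
      refine MvPolynomial.algHom_ext fun i => ?_
      simp only [AlgHom.comp_apply, Ideal.Quotient.mkₐ_eq_mk, hadamardComul, aeval_X, rename_X]
      rw [Ideal.Quotient.eq]
      refine Ideal.subset_span ⟨i, ?_⟩
      simp [ψ]
    exact congrArg (fun f : MvPolynomial σ K →ₐ[K] _ => f F) this
  rw [mem_hadamardIdeal]
  have := add_mem (Ideal.mem_sup_right hmod) (hle h)
  rwa [sub_add_cancel] at this

/-- Modulo the tensor ideal `X i ⊗ X i` becomes `p i q i (X 0 ⊗ X 0)`, so the image of the form is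
its value at `p ⋆ q` times `X 0 ⊗ X 0`. -/
theorem hadamardComul_linForm_mem {I J : Ideal (MvPolynomial (Fin 3) K)} {p q l : Fin 3 → K}
    (hI : ∀ i, X i - C (p i) * X 0 ∈ I) (hJ : ∀ i, X i - C (q i) * X 0 ∈ J)
    (hl : ∑ i, l i * (p i * q i) = 0) :
    hadamardComul K (Fin 3) (linForm l) ∈ tensorIdeal I J := by
  have hX : ∀ i, (X i ⊗ₜ X i - (C (p i * q i) * X 0) ⊗ₜ X 0 :
      MvPolynomial (Fin 3) K ⊗[K] MvPolynomial (Fin 3) K) ∈ tensorIdeal I J := by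
    intro i
    have h1 := Ideal.mul_mem_right ((1 : MvPolynomial (Fin 3) K) ⊗ₜ[K] X i) _
      (Ideal.mem_map_of_mem (Algebra.TensorProduct.includeLeft :
        _ →ₐ[K] MvPolynomial (Fin 3) K ⊗[K] MvPolynomial (Fin 3) K) (hI i))
    have h2 := Ideal.mul_mem_right ((C (p i) * X 0 : MvPolynomial (Fin 3) K) ⊗ₜ[K] 1) _
      (Ideal.mem_map_of_mem (Algebra.TensorProduct.includeRight :
        _ →ₐ[K] MvPolynomial (Fin 3) K ⊗[K] MvPolynomial (Fin 3) K) (hJ i))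
    have := add_mem (Ideal.mem_sup_left h1) (Ideal.mem_sup_right h2)
    have hC : (C (p i * q i) * X 0 : MvPolynomial (Fin 3) K) ⊗ₜ[K]
        (X 0 : MvPolynomial (Fin 3) K) = (C (p i) * X 0 : MvPolynomial (Fin 3) K) ⊗ₜ[K]
          (C (q i) * X 0 : MvPolynomial (Fin 3) K) := by
      rw [← smul_eq_C_mul, ← smul_eq_C_mul, ← smul_eq_C_mul, TensorProduct.smul_tmul_smul]
      rw [TensorProduct.smul_tmul']
    simp only [Algebra.TensorProduct.includeLeft_apply,
      Algebra.TensorProduct.includeRight_apply, Algebra.TensorProduct.tmul_mul_tmul, mul_one, one_mul, TensorProduct.sub_tmul,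
      TensorProduct.tmul_sub, sub_mul, sub_add_sub_cancel] at this
    rwa [hC]
  have hsum : hadamardComul K (Fin 3) (linForm l) =
      ∑ i, l i • (X i ⊗ₜ X i - (C (p i * q i) * X 0) ⊗ₜ X 0 :
        MvPolynomial (Fin 3) K ⊗[K] MvPolynomial (Fin 3) K) := by
    have h0 : ∑ i, l i • ((C (p i * q i) * X 0 : MvPolynomial (Fin 3) K) ⊗ₜ[K]
        (X 0 : MvPolynomial (Fin 3) K)) = 0 := by
      simp only [← smul_eq_C_mul, ← TensorProduct.smul_tmul', smul_smul]
      rw [← Finset.sum_smul, hl, zero_smul]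
    simp only [smul_sub, Finset.sum_sub_distrib]
    rw [h0, sub_zero]
    simp only [linForm, hadamardComul, map_sum, ← smul_eq_C_mul, map_smul, aeval_X]
  rw [hsum]
  exact sum_mem fun i _ => Submodule.smul_of_tower_mem _ _ (hX i)

end TensorIdeal

/-! ### Affine representatives and equations of the grid lines. -/

section Projective

variable {K : Type*} [Field K]

/-- The representative of a point whose coordinate `0` is equal to `1`. -/
noncomputable def affineRep (p : ProjPlane K) : Fin 3 → K := fun i => p.rep i / p.rep 0

theorem rep_ne_zero_of_notMem {p : ProjPlane K} (hp : p ∉ coordLines K) (i : Fin 3) :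
    p.rep i ≠ 0 := fun h => hp ⟨i, h⟩

theorem affineRep_zero {p : ProjPlane K} (hp : p ∉ coordLines K) : affineRep p 0 = 1 :=
  div_self (rep_ne_zero_of_notMem hp 0)

theorem affineRep_ne_zero {p : ProjPlane K} (hp : p ∉ coordLines K) (i : Fin 3) :
    affineRep p i ≠ 0 :=
  div_ne_zero (rep_ne_zero_of_notMem hp i) (rep_ne_zero_of_notMem hp 0)

theorem rep_eq_smul_affineRep {p : ProjPlane K} (hp : p ∉ coordLines K) (i : Fin 3) :
    p.rep i = p.rep 0 * affineRep p i :=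
  (mul_div_cancel₀ _ (rep_ne_zero_of_notMem hp 0)).symm

theorem eval_affineRep_of_mem_pointIdeal {p : ProjPlane K} {f : MvPolynomial (Fin 3) K}
    (hf : f ∈ pointIdeal p) : eval (affineRep p) f = 0 := by
  have hle : pointIdeal p ≤ RingHom.ker (eval (affineRep p)) := by
    refine Ideal.span_le.2 ?_
    rintro g ⟨⟨d, hd⟩, hg⟩
    have : affineRep p = (p.rep 0)⁻¹ • p.rep := by
      ext i
      simp [affineRep, div_eq_inv_mul]
    rw [SetLike.mem_coe, RingHom.mem_ker, this,
      eval_smul_of_germ_zero (germ_zero_of_isHomogeneous hd), hg, mul_zero]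
  exact hle hf

theorem X_sub_mem_pointIdeal {p : ProjPlane K} (hp : p ∉ coordLines K) (i : Fin 3) :
    X i - C (affineRep p i) * X 0 ∈ pointIdeal p := by
  refine Ideal.subset_span ⟨⟨1, (isHomogeneous_X K i).sub (isHomogeneous_C_mul_X _ 0)⟩, ?_⟩
  simp [affineRep, div_mul_cancel₀ _ (rep_ne_zero_of_notMem hp 0)]

theorem IsProjLine.exists_equation {L : Set (ProjPlane K)} (hL : IsProjLine L) :
    ∃ l : Fin 3 → K, l ≠ 0 ∧ ∀ p : ProjPlane K, p ∈ L ↔ ∑ i, l i * p.rep i = 0 := by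
  obtain ⟨W, hW, rfl⟩ := hL
  have hlt : W < ⊤ := by
    rw [lt_top_iff_ne_top]
    rintro rfl
    simp at hW
  obtain ⟨f, hf, hWf⟩ := Submodule.exists_le_ker_of_lt_top W hlt
  have hker : W = LinearMap.ker f := by
    refine Submodule.eq_of_le_of_finrank_eq hWf ?_
    have h1 := LinearMap.finrank_range_add_finrank_ker f
    rw [LinearMap.range_eq_top.2 (LinearMap.surjective hf)] at h1
    simp at h1
    omega
  have hfx : ∀ x : Fin 3 → K, f x = ∑ i, f (Pi.single i 1) * x i := by
    intro x
    conv_lhs => rw [pi_eq_sum_univ' x, map_sum]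
    refine Finset.sum_congr rfl fun i _ => ?_
    rw [map_smul, smul_eq_mul, mul_comm]
  refine ⟨fun i => f (Pi.single i 1), ?_, fun p => ?_⟩
  · intro h
    apply hf
    ext i
    simpa using congrFun h i
  · rw [← hfx, Set.mem_ofPred_eq, Projectivization.submodule_eq, hker,
      Submodule.span_singleton_le_iff_mem, LinearMap.mem_ker]

theorem rep_mul_rep_ne_zero {p q : ProjPlane K} (hp : p ∉ coordLines K) :
    (fun i => p.rep i * q.rep i) ≠ 0 := by
  intro h
  refine q.rep_nonzero (funext fun i => ?_)
  exact (mul_eq_zero.1 (congrFun h i)).resolve_left (rep_ne_zero_of_notMem hp i)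

theorem hadamardPoint_eq_some {p q : ProjPlane K} (hp : p ∉ coordLines K) :
    hadamardPoint p q = some (Projectivization.mk K _ (rep_mul_rep_ne_zero (q := q) hp)) := by
  rw [hadamardPoint, dif_pos]

theorem hadamardPoint_eq_of_affineRep {p q p' q' : ProjPlane K} (hp : p ∉ coordLines K)
    (hq : q ∉ coordLines K) (hp' : p' ∉ coordLines K) (hq' : q' ∉ coordLines K)
    (h : affineRep p * affineRep q = affineRep p' * affineRep q') :
    hadamardPoint p q = hadamardPoint p' q' := by
  rw [hadamardPoint_eq_some hp, hadamardPoint_eq_some hp', Option.some_inj,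
    Projectivization.mk_eq_mk_iff']
  refine ⟨p.rep 0 * q.rep 0 / (p'.rep 0 * q'.rep 0), funext fun i => ?_⟩
  have hi := congrFun h i
  have h1 := rep_ne_zero_of_notMem hp' 0
  have h2 := rep_ne_zero_of_notMem hq' 0
  simp only [Pi.mul_apply, Pi.smul_apply, smul_eq_mul] at hi ⊢
  rw [rep_eq_smul_affineRep hp i, rep_eq_smul_affineRep hq i, rep_eq_smul_affineRep hp' i,
    rep_eq_smul_affineRep hq' i]
  field_simp
  linear_combination (-(p.rep 0 * q.rep 0)) * hi

/-- The equation of the line `p ⋆ L`. -/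
theorem mem_hadamardSet_iff {p : ProjPlane K} (hp : p ∉ coordLines K) {L : Set (ProjPlane K)}
    {l : Fin 3 → K} (hl : ∀ q : ProjPlane K, q ∈ L ↔ ∑ i, l i * q.rep i = 0) (x : ProjPlane K) :
    x ∈ hadamardSet p L ↔ ∑ i, l i / affineRep p i * x.rep i = 0 := by
  have hp0 := rep_ne_zero_of_notMem hp
  constructor
  · rintro ⟨q, hq, hx⟩
    rw [hadamardPoint_eq_some hp, Option.some_inj] at hx
    obtain ⟨c, hc⟩ := Projectivization.exists_smul_eq_mk_rep K _ (rep_mul_rep_ne_zero (q := q) hp)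
    rw [hx] at hc
    rw [hl] at hq
    rw [← hc]
    calc _ = (c : K) * p.rep 0 * ∑ i, l i * q.rep i := by
          rw [Finset.mul_sum]
          refine Finset.sum_congr rfl fun i _ => ?_
          have := hp0 i
          have := hp0 0
          simp only [affineRep, Pi.smul_apply, Units.smul_def, smul_eq_mul]
          field_simp
      _ = 0 := by rw [hq, mul_zero]
  · intro h
    have hne : (fun i => x.rep i / p.rep i) ≠ 0 := by
      intro h0
      refine x.rep_nonzero (funext fun i => ?_)
      exact (div_eq_zero_iff.1 (congrFun h0 i)).resolve_right (hp0 i)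
    obtain ⟨c, hc⟩ := Projectivization.exists_smul_eq_mk_rep K _ hne
    refine ⟨Projectivization.mk K _ hne, ?_, ?_⟩
    · rw [hl, ← hc]
      calc _ = (c : K) / p.rep 0 * ∑ i, l i / affineRep p i * x.rep i := by
            rw [Finset.mul_sum]
            refine Finset.sum_congr rfl fun i _ => ?_
            have := hp0 i
            have := hp0 0
            simp only [affineRep, Pi.smul_apply, Units.smul_def, smul_eq_mul]
            field_simp
        _ = 0 := by rw [h, mul_zero]
    · rw [hadamardPoint_eq_some hp, Option.some_inj]
      conv_rhs => rw [← x.mk_rep]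
      rw [Projectivization.mk_eq_mk_iff']
      refine ⟨c, funext fun i => ?_⟩
      have := hp0 i
      rw [← hc]
      simp only [Pi.smul_apply, Units.smul_def, smul_eq_mul]
      field_simp

/-- Two lines with two common points have the same points. -/
theorem sum_mul_eq_zero_of_common_points {l l' u v : Fin 3 → K} (hl : l ≠ 0) (hu0 : u 0 = 1)
    (hv0 : v 0 = 1) (huv : u ≠ v) (hu : ∑ i, l i * u i = 0) (hv : ∑ i, l i * v i = 0)
    (hu' : ∑ i, l' i * u i = 0) (hv' : ∑ i, l' i * v i = 0) {x : Fin 3 → K}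
    (hx : ∑ i, l i * x i = 0) : ∑ i, l' i * x i = 0 := by
  obtain ⟨w, hw⟩ := exists_line_direction hl hu hu0
  obtain ⟨b, hb⟩ := hw v hv
  obtain ⟨c, hc⟩ := hw x hx
  rw [hv0, one_smul] at hb
  have hb0 : b ≠ 0 := by
    rintro rfl
    exact huv (by simpa using hb.symm)
  have hw' : ∑ i, l' i * w i = 0 := by
    rw [hb] at hv'
    simp only [Pi.add_apply, Pi.smul_apply, smul_eq_mul, mul_add, Finset.sum_add_distrib, hu',
      zero_add, mul_left_comm _ b, ← Finset.mul_sum] at hv'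
    exact (mul_eq_zero.1 hv').resolve_left hb0
  rw [hc]
  simp only [Pi.add_apply, Pi.smul_apply, smul_eq_mul, mul_add, Finset.sum_add_distrib,
    mul_left_comm _ c, mul_left_comm _ (x 0), ← Finset.mul_sum, hu', hw', mul_zero, add_zero]

theorem div_affineRep_ne_zero {p : ProjPlane K} (hp : p ∉ coordLines K) {l : Fin 3 → K}
    (hl : l ≠ 0) : (fun k => l k / affineRep p k) ≠ 0 := by
  intro h
  refine hl (funext fun k => ?_)
  exact (div_eq_zero_iff.1 (congrFun h k)).resolve_right (affineRep_ne_zero hp k)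

theorem sum_div_mul_affineRep {p q : ProjPlane K} (hp : p ∉ coordLines K) (hq : q ∉ coordLines K)
    {l : Fin 3 → K} (hl : ∑ k, l k * q.rep k = 0) :
    ∑ k, l k / affineRep p k * (affineRep p k * affineRep q k) = 0 := by
  calc _ = (q.rep 0)⁻¹ * ∑ k, l k * q.rep k := by
        rw [Finset.mul_sum]
        refine Finset.sum_congr rfl fun k _ => ?_
        have := affineRep_ne_zero hp k
        have := rep_ne_zero_of_notMem hq 0
        rw [rep_eq_smul_affineRep hq k]
        field_simp
    _ = 0 := by rw [hl, mul_zero]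

/-- Equations of the lines `Pᵢ ⋆ ℓ_Q` and `ℓ_P ⋆ Qⱼ` of a Hadamard grid. -/
theorem IsHadamardGrid.exists_lines {r s : ℕ} {P : Fin r → ProjPlane K} {Q : Fin s → ProjPlane K}
    (h : IsHadamardGrid P Q) :
    ∃ (lP : Fin r → Fin 3 → K) (lQ : Fin s → Fin 3 → K), (∀ i, lP i ≠ 0) ∧ (∀ j, lQ j ≠ 0) ∧
      (∀ i j, ∑ k, lP i k * (affineRep (P i) k * affineRep (Q j) k) = 0) ∧
      (∀ i j, ∑ k, lQ j k * (affineRep (P i) k * affineRep (Q j) k) = 0) ∧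
      ∀ i i' j, i ≠ i' → ∑ k, lP i k * (affineRep (P i') k * affineRep (Q j) k) ≠ 0 := by
  obtain ⟨LP, LQ, hLP, hLQ, hP, hQ, hne⟩ := h.lines
  obtain ⟨lP, hlP0, hlP⟩ := hLP.exists_equation
  obtain ⟨lQ, hlQ0, hlQ⟩ := hLQ.exists_equation
  have hrow : ∀ i j, ∑ k, lQ k / affineRep (P i) k * (affineRep (P i) k * affineRep (Q j) k) = 0 :=
    fun i j => sum_div_mul_affineRep (h.left_notMem i) (h.right_notMem j) ((hlQ _).1 (hQ j))
  have hcol : ∀ i j,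
      ∑ k, lP k / affineRep (Q j) k * (affineRep (P i) k * affineRep (Q j) k) = 0 := by
    intro i j
    have := sum_div_mul_affineRep (h.right_notMem j) (h.left_notMem i) ((hlP _).1 (hP i))
    simpa only [mul_comm (affineRep (Q j) _)] using this
  refine ⟨fun i k => lQ k / affineRep (P i) k, fun j k => lP k / affineRep (Q j) k,
    fun i => div_affineRep_ne_zero (h.left_notMem i) hlQ0,
    fun j => div_affineRep_ne_zero (h.right_notMem j) hlP0, hrow, hcol, ?_⟩
  intro i i' j hii' h0
  have hz : ∀ i, (affineRep (P i) * affineRep (Q j)) 0 = 1 := fun i => by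
    rw [Pi.mul_apply, affineRep_zero (h.left_notMem i), affineRep_zero (h.right_notMem j), one_mul]
  have huv : affineRep (P i) * affineRep (Q j) ≠ affineRep (P i') * affineRep (Q j) := by
    intro he
    have := h.injective (a₁ := (i, j)) (a₂ := (i', j))
      (hadamardPoint_eq_of_affineRep (h.left_notMem i) (h.right_notMem j) (h.left_notMem i')
        (h.right_notMem j) he)
    exact hii' (congrArg Prod.fst this)
  -- If the `i`-th row line met column `j` in the point of row `i'` too, the two lines would share
  -- two distinct points and coincide, contrary to the grid condition.
  refine hne i j (Set.ext fun x => ?_)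
  rw [mem_hadamardSet_iff (h.left_notMem i) hlQ, mem_hadamardSet_iff (h.right_notMem j) hlP]
  exact ⟨sum_mul_eq_zero_of_common_points (div_affineRep_ne_zero (h.left_notMem i) hlQ0) (hz i)
      (hz i') huv (hrow i j) h0 (hcol i j) (hcol i' j),
    sum_mul_eq_zero_of_common_points (div_affineRep_ne_zero (h.right_notMem j) hlP0) (hz i)
      (hz i') huv (hcol i j) (hcol i' j) (hrow i j) h0⟩

end Projective

/-! ### The two degree bounds, and degrees of generators. -/

section FatGrid

variable {K : Type*} [Field K]

/-- Lower bound for the degree of a form of the ideal of a Hadamard fat grid, from the points of as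
many columns as there are rows. -/
theorem IsHadamardGrid.sum_le_degree_add [CharZero K] {r s : ℕ} (hr : 1 ≤ r)
    {P : Fin r → ProjPlane K} {Q : Fin s → ProjPlane K} (h : IsHadamardGrid P Q)
    {m : Fin r → ℕ} {n : Fin s → ℕ} (hm : ∀ i, 0 < m i) (hn : ∀ j, 0 < n j)
    {τ : Fin r → Fin s} (hτ : Function.Injective τ) {F : MvPolynomial (Fin 3) K} {d : ℕ}
    (hF : F ∈ hadamardFatGridIdeal P m Q n) (hF0 : F ≠ 0) (hd : F.IsHomogeneous d) :
    ∑ i, m i + ∑ i, n (τ i) ≤ d + r := by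
  obtain ⟨lP, -, hlP0, -, hrow, -, hne⟩ := h.exists_lines
  have hinj : ∀ i, Function.Injective
      fun i' => affineRep (P i) * affineRep (Q (τ i')) := by
    intro i i₁ i₂ he
    have := h.injective (a₁ := (i, τ i₁)) (a₂ := (i, τ i₂))
      (hadamardPoint_eq_of_affineRep (h.left_notMem _) (h.right_notMem _) (h.left_notMem _)
        (h.right_notMem _) he)
    exact hτ (congrArg Prod.snd this)
  have key := sum_multiplicity_le_card_mul (ι := Fin r) (κ := Fin r) le_rfl hlP0
    (v := fun i i' => affineRep (P i) * affineRep (Q (τ i')))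
    (fun i i' => by
      rw [Pi.mul_apply, affineRep_zero (h.left_notMem _), affineRep_zero (h.right_notMem _),
        one_mul])
    (fun i i' => hrow i (τ i')) (fun i i' j hi => hne i i' (τ j) hi) hinj hF0
    (germ_zero_of_isHomogeneous hd) hd.totalDegree_le
    (k := fun i i' => m i + n (τ i') - 1) (fun i i' => by
      have hle := hadamardIdeal_mono (iInf_le (fun i => pointIdeal (P i) ^ m i) i)
        (iInf_le (fun j => pointIdeal (Q j) ^ n j) (τ i')) hF
      have hm' := hm i
      have hn' := hn (τ i')
      -- With exponents `(m i - 1) + 1` and `(n (τ i') - 1) + 1` the multiplicity is `m i + n (τ i')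
      -- - 1`.
      rw [← Nat.sub_add_cancel hm', ← Nat.sub_add_cancel hn'] at hle
      have := X_pow_dvd_germ_of_mem_hadamardIdeal (affineRep_ne_zero (h.left_notMem i))
        (affineRep_ne_zero (h.right_notMem (τ i')))
        (fun f hf => eval_affineRep_of_mem_pointIdeal hf)
        (fun f hf => eval_affineRep_of_mem_pointIdeal hf) _ _ hle
      exact (pow_dvd_pow _ (by omega)).trans this)
  rw [Fintype.card_fin] at key
  have hsum : ∑ i : Fin r, ∑ i' : Fin r, (m i + n (τ i') - 1) + r * r =
      r * (∑ i, m i + ∑ i, n (τ i)) := by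
    calc _ = ∑ i : Fin r, ∑ i' : Fin r, ((m i + n (τ i') - 1) + 1) := by
          simp [Finset.sum_add_distrib]
      _ = ∑ i : Fin r, ∑ i' : Fin r, (m i + n (τ i')) :=
          Finset.sum_congr rfl fun i _ => Finset.sum_congr rfl fun i' _ => by
            have := hm i
            omega
      _ = _ := by
          simp [Finset.sum_add_distrib, ← Finset.mul_sum, mul_add]
  refine Nat.le_of_mul_le_mul_left ?_ hr
  rw [← hsum, mul_add]
  omega

/-- Products of lines in the ideal of a Hadamard fat grid. -/
theorem IsHadamardGrid.exists_form [Infinite K] {r s : ℕ}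
    {P : Fin r → ProjPlane K} {Q : Fin s → ProjPlane K} (h : IsHadamardGrid P Q)
    {m : Fin r → ℕ} {n : Fin s → ℕ} (hm : ∀ i, 0 < m i) (hn : ∀ j, 0 < n j) (c : ℕ) :
    ∃ F ∈ hadamardFatGridIdeal P m Q n,
      F.IsHomogeneous (∑ i, (m i - 1 + c) + ∑ j, (n j - c)) ∧ F ≠ 0 := by
  obtain ⟨lP, lQ, hlP0, hlQ0, hrow, hcol, -⟩ := h.exists_lines
  -- At the point `(i, j)` the exponents add up to at least `m i + n j - 1` for every `c`, also
  -- where `n j - c` is truncated to 0.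
  refine ⟨(∏ i, linForm (lP i) ^ (m i - 1 + c)) * ∏ j, linForm (lQ j) ^ (n j - c), ?_, ?_, ?_⟩
  · refine mem_hadamardIdeal_of_hadamardComul_mem (mem_tensorIdeal_iInf fun i j => ?_)
    obtain ⟨G, hG⟩ := mul_dvd_mul
      (Finset.dvd_prod_of_mem (fun i => linForm (lP i) ^ (m i - 1 + c)) (Finset.mem_univ i))
      (Finset.dvd_prod_of_mem (fun j => linForm (lQ j) ^ (n j - c)) (Finset.mem_univ j))
    rw [hG, map_mul, map_mul, map_pow, map_pow]
    refine Ideal.mul_mem_right _ _ ?_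
    have hm' := hm i
    have hn' := hn j
    have h1 := hadamardComul_linForm_mem (X_sub_mem_pointIdeal (h.left_notMem i))
      (X_sub_mem_pointIdeal (h.right_notMem j)) (hrow i j)
    have h2 := hadamardComul_linForm_mem (X_sub_mem_pointIdeal (h.left_notMem i))
      (X_sub_mem_pointIdeal (h.right_notMem j)) (hcol i j)
    rw [← Nat.sub_add_cancel hm', ← Nat.sub_add_cancel hn']
    exact pow_mul_pow_mem_tensorIdeal h1 h2 (by omega)
  · refine IsHomogeneous.mul ?_ ?_
    · refine IsHomogeneous.prod _ _ _ fun i _ => ?_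
      simpa using (linForm_isHomogeneous (lP i)).pow (m i - 1 + c)
    · refine IsHomogeneous.prod _ _ _ fun j _ => ?_
      simpa using (linForm_isHomogeneous (lQ j)).pow (n j - c)
  · exact mul_ne_zero
      (Finset.prod_ne_zero_iff.2 fun i _ => pow_ne_zero _ (linForm_ne_zero (hlP0 i)))
      (Finset.prod_ne_zero_iff.2 fun j _ => pow_ne_zero _ (linForm_ne_zero (hlQ0 j)))

/-- The initial degree of an ideal is the least degree of any set of non-zero homogeneous
generators. -/
theorem IsInitialDegree.isLeast_totalDegree {σ : Type*} {I : Ideal (MvPolynomial σ K)} {a : ℕ}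
    (h : IsInitialDegree I a) {G : Set (MvPolynomial σ K)}
    (hG : ∀ g ∈ G, g ≠ 0 ∧ ∃ d : ℕ, g.IsHomogeneous d) (hI : Ideal.span G = I) :
    IsLeast (MvPolynomial.totalDegree '' G) a := by
  have hlow : ∀ g ∈ G, a ≤ g.totalDegree := by
    intro g hg
    obtain ⟨hg0, d, hd⟩ := hG g hg
    rw [hd.totalDegree hg0]
    exact h.2 ⟨g, hI ▸ Ideal.subset_span hg, hd, hg0⟩
  refine ⟨?_, ?_⟩
  · by_contra hnot
    have hlt : ∀ g ∈ G, a + 1 ≤ g.totalDegree := fun g hg =>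
      Nat.succ_le_of_lt (lt_of_le_of_ne (hlow g hg) fun he => hnot ⟨g, hg, he.symm⟩)
    obtain ⟨f, hf, hfd, hf0⟩ := h.1
    -- If all generators had degree above `a`, the whole ideal would have order above `a` at the
    -- origin, whereas `f` has order exactly `a`.
    have hle : I ≤ (Ideal.span {Polynomial.X ^ (a + 1)}).comap (germ (0 : σ → K)) := by
      rw [← hI, Ideal.span_le]
      intro g hg
      obtain ⟨hg0, d, hd⟩ := hG g hg
      rw [SetLike.mem_coe, Ideal.mem_comap, Ideal.mem_span_singleton,
        germ_zero_of_isHomogeneous hd]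
      refine Dvd.dvd.mul_right (pow_dvd_pow _ ?_) _
      rw [← hd.totalDegree hg0]
      exact hlt g hg
    have := hle hf
    rw [Ideal.mem_comap, Ideal.mem_span_singleton, germ_zero_of_isHomogeneous hfd, pow_succ,
      mul_dvd_mul_iff_left (pow_ne_zero _ Polynomial.X_ne_zero), Polynomial.X_dvd_iff,
      Polynomial.coeff_C_zero] at this
    exact hf0 this
  · rintro _ ⟨g, hg, rfl⟩
    exact hlow g hg

/-- With `c` the smallest of the last `r` values of `n`, all earlier columns have `n j ≤ c` and
contribute 0. The term `r * c` is what the row lines pay in the product of lines. -/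
theorem sum_tsub_eq_sum_last {r s : ℕ} (hrs : r ≤ s) {n : Fin s → ℕ} (hn : Monotone n)
    (i₀ : Fin r) (hi₀ : ∀ i, i ≤ i₀) :
    ∑ j, (n j - n (Fin.rev (Fin.castLE hrs i₀))) + r * n (Fin.rev (Fin.castLE hrs i₀)) =
      ∑ i, n (Fin.rev (Fin.castLE hrs i)) := by
  set c := n (Fin.rev (Fin.castLE hrs i₀))
  have hinj : Function.Injective fun i : Fin r => Fin.rev (Fin.castLE hrs i) :=
    Fin.rev_injective.comp (Fin.castLE_injective hrs)
  rw [← Fintype.sum_of_injective _ hinj (fun i => n (Fin.rev (Fin.castLE hrs i)) - c)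
    (fun j => n j - c) (fun j hj => ?_) fun _ => rfl]
  · calc _ = ∑ i : Fin r, (n (Fin.rev (Fin.castLE hrs i)) - c + c) := by
          simp [Finset.sum_add_distrib]
      _ = _ := Finset.sum_congr rfl fun i _ => Nat.sub_add_cancel (hn (by
          rw [Fin.rev_le_rev]
          exact hi₀ i))
  · refine Nat.sub_eq_zero_of_le (hn ?_)
    by_contra! hlt
    refine hj ⟨⟨(Fin.rev j).val, ?_⟩, ?_⟩
    · have := i₀.isLt
      rw [Fin.lt_def] at hlt
      simp only [Fin.val_rev, Fin.val_castLE] at hlt ⊢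
      omega
    · ext
      simp only [Fin.val_rev, Fin.val_castLE]
      omega

end FatGrid

/-! ### The initial degree of the fat grid ideal. -/

theorem proposition5p11 {K : Type*} [Field K] [IsAlgClosed K] [CharZero K]
    {r s : ℕ} (hr : 1 ≤ r) (hrs : r ≤ s)
    (P : Fin r → ProjPlane K) (Q : Fin s → ProjPlane K) (hPQ : IsHadamardGrid P Q)
    (m : Fin r → ℕ) (n : Fin s → ℕ) (hm : ∀ i, 0 < m i) (hn : ∀ j, 0 < n j)
    (hm_mono : Monotone m) (hn_mono : Monotone n) :
    IsInitialDegree (hadamardFatGridIdeal P m Q n)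
        (∑ i : Fin r, m i + ∑ i : Fin r, n (Fin.rev (Fin.castLE hrs i)) - r) ∧
      ∀ G : Set (MvPolynomial (Fin 3) K),
        (∀ g ∈ G, g ≠ 0 ∧ ∃ d : ℕ, g.IsHomogeneous d) →
        Ideal.span G = hadamardFatGridIdeal P m Q n →
        IsLeast (MvPolynomial.totalDegree '' G)
          (∑ i : Fin r, m i + ∑ i : Fin r, n (Fin.rev (Fin.castLE hrs i)) - r) := by
  have hα : IsInitialDegree (hadamardFatGridIdeal P m Q n)
      (∑ i : Fin r, m i + ∑ i : Fin r, n (Fin.rev (Fin.castLE hrs i)) - r) := by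
    refine ⟨?_, ?_⟩
    · let i₀ : Fin r := ⟨r - 1, by omega⟩
      have hi₀ : ∀ i, i ≤ i₀ := fun i => by
        rw [Fin.le_def]
        have := i.isLt
        simp only [i₀]
        omega
      -- Here `c` is the `r`-th largest of the `n j`, the value for which the degree of the product
      -- meets the lower bound.
      obtain ⟨F, hF, hd, hF0⟩ := hPQ.exists_form hm hn (n (Fin.rev (Fin.castLE hrs i₀)))
      refine ⟨F, hF, ?_, hF0⟩
      convert hd using 1
      rw [← sum_tsub_eq_sum_last hrs hn_mono i₀ hi₀]
      have hsum : ∑ i, (m i - 1) + r = ∑ i, m i := by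
        calc _ = ∑ i, (m i - 1 + 1) := by simp [Finset.sum_add_distrib]
          _ = _ := Finset.sum_congr rfl fun i _ => Nat.sub_add_cancel (hm i)
      rw [← hsum, Finset.sum_add_distrib, Finset.sum_const, Finset.card_univ, Fintype.card_fin,
        smul_eq_mul]
      omega
    · rintro d ⟨F, hF, hd, hF0⟩
      have := hPQ.sum_le_degree_add hr hm hn
        (Fin.rev_injective.comp (Fin.castLE_injective hrs)) hF hF0 hd
      simp only [Function.comp_apply] at this
      omega
  exact ⟨hα, fun G hG hI => hα.isLeast_totalDegree hG hI⟩
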